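/- Let $n\ge 0$ and let $(K,R)$ be one of the following: $K$ a field of characteristic zero and $R=K[X_1,\dots,X_n]$; $K$ a field of characteristic zero and $R=K[[X_1,\dots,X_n]]$; or $K=\mathbb{C}$ and $R=\mathbb{C}\{z_1,\dots,z_n\}$, the ring of power series that converge absolutely on some polydisc of positive radius around the origin. Let $D\subseteq \operatorname{End}_K(R)$ be the ring of all $K$-linear differential operators of finite order on $R$ (in the sense of Grothendieck: $P$ has order $\le 0$ if it commutes with all multiplications by elements of $R$, and order $\le m+1$ if $[P,a]$ has order $\le m$ for every $a\in R$), and regard $R$ as a subring of $D$ acting by multiplication. Let $\partial_i$ denote the partial derivative with respect to the $i$-th variable and put $\partial^\alpha=\partial_1^{\alpha_1}\cdots\partial_n^{\alpha_n}$ for $\alpha\in\mathbb{N}^n$. Then: 1. $D$ is free as a right $R$-module. More precisely, the operators $\partial^\alpha$, $\alpha\in\mathbb{N}^n$, lie in $D$ and form a basis of $D$ as a right $R$-module: every $s\in D$ has a unique expression as a finite sum $s=\sum_{\alpha}\partial^\alpha\psi_\alpha$ with $\psi_\alpha\in R$. 2. Every injective left $D$-module is injective when it is regarded as an $R$-module by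 restriction of scalars along $R\subseteq D$. -/

import Mathlib

universe u v

/-- `IsDiffOp K R m P`: the `K`-linear endomorphism `P` of the commutative `K`-algebra `R` is a
`K`-linear differential operator of order at most `m`, in the sense of Grothendieck: operators of
order `≤ 0` commute with all multiplications by elements of `R`, and `P` has order `≤ m + 1` when
the commutator of `P` with every multiplication operator has order `≤ m`. -/
def IsDiffOp (K R : Type*) [CommRing K] [CommRing R] [Algebra K R] :
    ℕ → Module.End K R → Prop
  | 0, P => ∀ a : R, P * LinearMap.mulLeft K a - LinearMap.mulLeft K a * P = 0
  | m + 1, P => ∀ a : R, IsDiffOp K R m (P * LinearMap.mulLeft K a - LinearMap.mulLeft K a * P)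

namespace IsDiffOp

variable {K R : Type*} [CommRing K] [CommRing R] [Algebra K R]

theorem zero (m : ℕ) : IsDiffOp K R m 0 := by
  induction m with
  | zero => intro a; simp
  | succ m ih => intro a; simpa using ih

theorem add {m : ℕ} : ∀ {P Q : Module.End K R}, IsDiffOp K R m P → IsDiffOp K R m Q →
    IsDiffOp K R m (P + Q) := by
  induction m with
  | zero =>
    intro P Q hP hQ a
    have h := congrArg₂ (· + ·) (hP a) (hQ a)
    simp only [add_zero] at h
    rw [← h]; noncomm_ring
  | succ m ih =>
    intro P Q hP hQ a
    have h := ih (hP a) (hQ a)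
    have e : (P + Q) * LinearMap.mulLeft K a - LinearMap.mulLeft K a * (P + Q) =
      (P * LinearMap.mulLeft K a - LinearMap.mulLeft K a * P) +
      (Q * LinearMap.mulLeft K a - LinearMap.mulLeft K a * Q) := by noncomm_ring
    rw [e]; exact h

theorem succ {m : ℕ} : ∀ {P : Module.End K R}, IsDiffOp K R m P → IsDiffOp K R (m + 1) P := by
  induction m with
  | zero => intro P hP a; rw [hP a]; exact zero 0
  | succ m ih => intro P hP a; exact ih (hP a)

theorem mono {m l : ℕ} (h : m ≤ l) {P : Module.End K R} (hP : IsDiffOp K R m P) :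
    IsDiffOp K R l P := by
  induction h with
  | refl => exact hP
  | step _ ih => exact succ ih

theorem mul_aux (N : ℕ) : ∀ {m l : ℕ} {P Q : Module.End K R}, m + l = N → IsDiffOp K R m P →
    IsDiffOp K R l Q → IsDiffOp K R N (P * Q) := by
  have e : ∀ (P Q A : Module.End K R), P * Q * A - A * (P * Q) =
      P * (Q * A - A * Q) + (P * A - A * P) * Q := by
    intro P Q A
    rw [mul_sub, sub_mul, mul_assoc, mul_assoc, mul_assoc, sub_add_sub_cancel]
  induction N with
  | zero =>
    intro m l P Q h hP hQ a
    obtain ⟨rfl, rfl⟩ : m = 0 ∧ l = 0 := by omega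
    rw [e, hP a, hQ a]; simp
  | succ N ih =>
    intro m l P Q h hP hQ a
    rw [e]
    refine add ?_ ?_
    · cases l with
      | zero => rw [hQ a, mul_zero]; exact zero N
      | succ l => exact ih (by omega) hP (hQ a)
    · cases m with
      | zero => rw [hP a, zero_mul]; exact zero N
      | succ m => exact ih (by omega) (hP a) hQ

theorem mul {m l : ℕ} {P Q : Module.End K R} (hP : IsDiffOp K R m P) (hQ : IsDiffOp K R l Q) :
    IsDiffOp K R (m + l) (P * Q) :=
  mul_aux (m + l) rfl hP hQ

theorem mulLeft (r : R) : IsDiffOp K R 0 (LinearMap.mulLeft K r) := by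
  intro a
  ext x
  simp [mul_left_comm]

end IsDiffOp

/-- The `K`-algebra of `K`-linear differential operators on `R` (of arbitrary finite order), as a
subalgebra of the `K`-linear endomorphisms of `R`. -/
def diffOpSubalgebra (K R : Type*) [CommRing K] [CommRing R] [Algebra K R] :
    Subalgebra K (Module.End K R) where
  carrier := {P | ∃ m, IsDiffOp K R m P}
  add_mem' := by
    rintro P Q ⟨m, hP⟩ ⟨l, hQ⟩
    exact ⟨max m l, (hP.mono (le_max_left _ _)).add (hQ.mono (le_max_right _ _))⟩
  mul_mem' := by
    rintro P Q ⟨m, hP⟩ ⟨l, hQ⟩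
    exact ⟨m + l, hP.mul hQ⟩
  algebraMap_mem' := by
    intro c
    refine ⟨0, ?_⟩
    have h := IsDiffOp.mulLeft (K := K) (algebraMap K R c)
    convert h using 1
    ext x
    simp [Algebra.smul_def]

/-- The ring `D` of `K`-linear differential operators on `R`. -/
def DiffOp (K R : Type*) [CommRing K] [CommRing R] [Algebra K R] : Type _ :=
  diffOpSubalgebra K R

namespace DiffOp

variable (K R : Type*) [CommRing K] [CommRing R] [Algebra K R]

noncomputable instance : Ring (DiffOp K R) :=
  inferInstanceAs (Ring (diffOpSubalgebra K R))

/-- The underlying endomorphism of a differential operator. -/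
def toEnd : DiffOp K R →+* Module.End K R :=
  (diffOpSubalgebra K R).val.toRingHom

/-- The inclusion `R → D`, sending `r` to multiplication by `r`. -/
def ofRing : R →+* DiffOp K R where
  toFun r := ⟨LinearMap.mulLeft K r, 0, IsDiffOp.mulLeft r⟩
  map_one' := Subtype.ext (LinearMap.ext fun x => one_mul x)
  map_mul' r s := Subtype.ext (LinearMap.ext fun x => mul_assoc r s x)
  map_zero' := Subtype.ext (LinearMap.ext fun x => zero_mul x)
  map_add' r s := Subtype.ext (LinearMap.ext fun x => add_mul r s x)

/-- `D` as a right `R`-module: `P · r = P ∘ (multiplication by r)`. -/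
noncomputable instance : Module Rᵐᵒᵖ (DiffOp K R) :=
  Module.compHom (DiffOp K R) (ofRing K R).op

theorem op_smul_eq_mul (r : R) (P : DiffOp K R) :
    MulOpposite.op r • P = P * ofRing K R r := rfl

theorem toEnd_ofRing (r x : R) : toEnd K R (ofRing K R r) x = r * x := rfl

end DiffOp

/-- The monomial `∂₁^α₁ ⋯ ∂ₙ^αₙ` in `K`-linear derivations `∂₁, …, ∂ₙ` of `A`, as a `K`-linear
endomorphism of `A`. -/
def derivMonomial {K A : Type*} [CommRing K] [CommRing A] [Algebra K A] {n : ℕ}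
    (d : Fin n → Derivation K A A) (α : Fin n →₀ ℕ) : Module.End K A :=
  (List.ofFn fun i => ((d i : A →ₗ[K] A) : Module.End K A) ^ α i).prod

/-- A power series over `ℂ` in `n` variables is convergent if it converges absolutely on some
polydisc of positive radius around the origin. -/
def IsConvergentSeries {n : ℕ} (f : MvPowerSeries (Fin n) ℂ) : Prop :=
  ∃ r : ℝ, 0 < r ∧ Summable fun α : Fin n →₀ ℕ => ‖MvPowerSeries.coeff α f‖ * r ^ α.degree

namespace IsConvergentSeries

variable {n : ℕ}

theorem mono_radius {f : MvPowerSeries (Fin n) ℂ} {r s : ℝ} (hs : 0 < s) (h : s ≤ r)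
    (hf : Summable fun α : Fin n →₀ ℕ => ‖MvPowerSeries.coeff α f‖ * r ^ α.degree) :
    Summable fun α : Fin n →₀ ℕ => ‖MvPowerSeries.coeff α f‖ * s ^ α.degree := by
  refine Summable.of_nonneg_of_le (fun α => by positivity) (fun α => ?_) hf
  gcongr

theorem add {f g : MvPowerSeries (Fin n) ℂ} (hf : IsConvergentSeries f)
    (hg : IsConvergentSeries g) : IsConvergentSeries (f + g) := by
  obtain ⟨r, hr, hf⟩ := hf
  obtain ⟨s, hs, hg⟩ := hg
  have ht : 0 < min r s := lt_min hr hs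
  refine ⟨min r s, ht, ?_⟩
  refine Summable.of_nonneg_of_le (fun α => by positivity) (fun α => ?_)
    ((mono_radius ht (min_le_left _ _) hf).add (mono_radius ht (min_le_right _ _) hg))
  rw [← add_mul, map_add]
  gcongr
  exact norm_add_le _ _

theorem mul {f g : MvPowerSeries (Fin n) ℂ} (hf : IsConvergentSeries f)
    (hg : IsConvergentSeries g) : IsConvergentSeries (f * g) := by
  obtain ⟨r, hr, hf⟩ := hf
  obtain ⟨s, hs, hg⟩ := hg
  obtain ⟨t, ht, htr, hts⟩ : ∃ t, 0 < t ∧ t ≤ r ∧ t ≤ s :=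
    ⟨min r s, lt_min hr hs, min_le_left r s, min_le_right r s⟩
  have h1 := mono_radius ht htr hf
  have h2 := mono_radius ht hts hg
  refine ⟨t, ht, ?_⟩
  have hn : ∀ (k : MvPowerSeries (Fin n) ℂ) (α : Fin n →₀ ℕ),
      0 ≤ ‖MvPowerSeries.coeff α k‖ * t ^ α.degree :=
    fun k α => mul_nonneg (norm_nonneg _) (pow_nonneg ht.le _)
  have h := summable_sum_mul_antidiagonal_of_summable_mul
    (Summable.mul_of_nonneg h1 h2 (hn f) (hn g))
  refine Summable.of_nonneg_of_le (hn (f * g)) (fun α => ?_) h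
  have hle : ‖MvPowerSeries.coeff α (f * g)‖ ≤ ∑ p ∈ Finset.HasAntidiagonal.antidiagonal α,
      ‖MvPowerSeries.coeff p.1 f * MvPowerSeries.coeff p.2 g‖ := by
    rw [MvPowerSeries.coeff_mul]
    exact norm_sum_le _ _
  refine (mul_le_mul_of_nonneg_right hle (pow_nonneg ht.le _)).trans ?_
  rw [Finset.sum_mul]
  refine Finset.sum_le_sum fun p hp => ?_
  have hd : α.degree = p.1.degree + p.2.degree := by
    rw [← Finset.HasAntidiagonal.mem_antidiagonal.mp hp, map_add]
  rw [hd, pow_add, norm_mul]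
  exact le_of_eq (mul_mul_mul_comm _ _ _ _)

theorem const (c : ℂ) : IsConvergentSeries (MvPowerSeries.C c : MvPowerSeries (Fin n) ℂ) := by
  classical
  refine ⟨1, one_pos, ?_⟩
  refine summable_of_ne_finset_zero (s := {0}) fun α hα => ?_
  rw [MvPowerSeries.coeff_C, if_neg (by simpa using hα)]
  simp

end IsConvergentSeries

/-- The ring `ℂ{z₁, …, zₙ}` of convergent power series, as a `ℂ`-subalgebra of
`ℂ[[z₁, …, zₙ]]`. -/
def convergentPowerSeries (n : ℕ) : Subalgebra ℂ (MvPowerSeries (Fin n) ℂ) where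
  carrier := {f | IsConvergentSeries f}
  add_mem' := IsConvergentSeries.add
  mul_mem' := IsConvergentSeries.mul
  algebraMap_mem' := IsConvergentSeries.const

/-! All three rings share two features: the `∂ᵢ` are dual to coordinates `xᵢ`, and a derivation
killing every `xᵢ` is zero. With characteristic zero, this already gives freeness. Under the normal
ordering `ofSymbol`, `∑ r_α ξ^α ↦ ∑ ∂^α r_α`, bracketing with `xᵢ` becomes `∂/∂ξᵢ`
(`ofSymbol_pderiv`); the kernel is thus stable under partial derivatives, and induction on the
degree makes it zero. Conversely, brackets with `xᵢ` are locally nilpotent on `D`. Subtracting terms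
`∂ᵢ^k Q / k!` makes them vanish one variable at a time, and an operator commuting with all `xᵢ` is a
multiplication (`eq_mulLeft_of_commute`).

The second claim needs only flatness: `D ⊗ -` is then exact and left adjoint to restriction of
scalars, so restriction preserves injectives (`Module.Injective.of_flat_right`).

For series rings, the rigidity of derivations comes from the division `f = f(0) + ∑ xᵢ gᵢ`: if `δ`
kills the `xᵢ`, then `δ f = ∑ xᵢ δ gᵢ`, and iterating shows that `δ f` vanishes to infinite order.
In the convergent case, division and `∂ᵢ` must also preserve convergence. -/

/-! ### Operators commuting with the coordinates -/

namespace IsDiffOp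

variable {K R : Type*} [CommRing K] [CommRing R] [Algebra K R]

theorem eq_mulLeft {P : Module.End K R} (hP : IsDiffOp K R 0 P) :
    P = LinearMap.mulLeft K (P 1) := by
  ext a
  have h := LinearMap.congr_fun (hP a) 1
  simp only [LinearMap.sub_apply, Module.End.mul_apply, LinearMap.mulLeft_apply, mul_one,
    LinearMap.zero_apply, sub_eq_zero] at h
  rw [h, LinearMap.mulLeft_apply, mul_comm]

theorem derivation (δ : Derivation K R R) : IsDiffOp K R 1 (δ : R →ₗ[K] R) := by
  intro a
  convert IsDiffOp.mulLeft (K := K) (δ a) using 1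
  ext f
  simp [mul_comm]

/-- If every derivation killing all `x i` vanishes, then a differential operator commuting with
all `x i` is a multiplication operator. -/
theorem eq_mulLeft_of_commute {ι : Type*} (x : ι → R)
    (hder : ∀ δ : Derivation K R R, (∀ i, δ (x i) = 0) → δ = 0) (m : ℕ) :
    ∀ P : Module.End K R, IsDiffOp K R m P → (∀ i, Commute P (LinearMap.mulLeft K (x i))) →
      P = LinearMap.mulLeft K (P 1) := by
  induction m with
  | zero => exact fun P hP _ => hP.eq_mulLeft
  | succ m ih =>
    intro P hP hx
    -- The bracket `[P, a]` has lower order and still commutes with every `x i`, so by induction it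
    -- is multiplication by its value at 1. The resulting identity says that `P - P 1` satisfies the
    -- Leibniz rule.
    have key : ∀ a b, P (a * b) = a * P b + b * (P a - a * P 1) := by
      intro a b
      have h := ih _ (hP a) fun i => by
        have hc : Commute (LinearMap.mulLeft K a) (LinearMap.mulLeft K (x i)) := by
          ext y; simp [mul_left_comm]
        exact ((hx i).mul_left hc).sub_left (hc.mul_left (hx i))
      have h' := LinearMap.congr_fun h b
      simp only [LinearMap.sub_apply, Module.End.mul_apply, LinearMap.mulLeft_apply,
        mul_one] at h'
      linear_combination h'
    let δ : Derivation K R R := Derivation.mk' (P - LinearMap.mulLeft K (P 1)) fun a b => by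
      simp only [LinearMap.sub_apply, LinearMap.mulLeft_apply, smul_eq_mul, key a b]
      ring
    have hδ : δ = 0 := hder δ fun i => by
      have h := LinearMap.congr_fun (hx i) 1
      simp only [Module.End.mul_apply, LinearMap.mulLeft_apply, mul_one] at h
      simp [δ, h, mul_comm]
    have h2 : ((δ : Derivation K R R) : R →ₗ[K] R) = 0 := by rw [hδ]; rfl
    exact sub_eq_zero.mp h2

end IsDiffOp

theorem commutator_pow_of_commutator_eq_one {A : Type*} [Ring A] {p x : A}
    (h : p * x - x * p = 1) (k : ℕ) : p ^ k * x - x * p ^ k = k * p ^ (k - 1) := by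
  induction k with
  | zero => simp
  | succ k ih =>
    have e : p ^ (k + 1) * x - x * p ^ (k + 1) =
        p ^ k * (p * x - x * p) + (p ^ k * x - x * p ^ k) * p := by noncomm_ring
    rw [e, h, ih, mul_assoc, ← pow_succ]
    cases k with
    | zero => simp
    | succ k => simp; noncomm_ring

theorem List.prod_ofFn_mul_of_commute {M : Type*} [Monoid M] {n : ℕ} (f g : Fin n → M)
    (h : ∀ i j, Commute (f i) (g j)) :
    (List.ofFn fun i => f i * g i).prod = (List.ofFn f).prod * (List.ofFn g).prod := by
  induction n with
  | zero => simp
  | succ n ih =>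
    have hc : Commute (List.ofFn fun i : Fin n => f i.succ).prod (g 0) := by
      refine Commute.list_prod_left _ _ fun y hy => ?_
      obtain ⟨i, rfl⟩ := List.mem_ofFn.mp hy
      exact h _ _
    simp only [List.ofFn_succ, List.prod_cons, ih _ _ fun i j => h i.succ j.succ]
    rw [mul_assoc, mul_assoc, ← mul_assoc (g 0), ← hc.eq, mul_assoc]

theorem List.prod_ofFn_pow_single {M : Type*} [Monoid M] {n : ℕ} (f : Fin n → M) (i : Fin n)
    (k : ℕ) : (List.ofFn fun j => f j ^ (Finsupp.single i k) j).prod = f i ^ k := by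
  induction n with
  | zero => exact i.elim0
  | succ n ih =>
    rw [List.ofFn_succ, List.prod_cons]
    refine Fin.cases ?_ (fun i => ?_) i
    · have : (List.ofFn fun j : Fin n => f j.succ ^ (Finsupp.single (0 : Fin (n + 1)) k) j.succ) =
          List.ofFn fun _ : Fin n => (1 : M) := by
        congr 1; ext j; simp
      rw [this]; simp
    · have : (List.ofFn fun j : Fin n => f j.succ ^ (Finsupp.single i.succ k) j.succ) =
          List.ofFn fun j : Fin n => f j.succ ^ (Finsupp.single i k) j := by
        congr 1; ext j; simp [Finsupp.single_apply]
      rw [this, ih (fun j => f j.succ)]; simp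

/-! ### Brackets with multiplication operators -/

namespace DiffOp

variable {K R : Type*} [CommRing K] [CommRing R] [Algebra K R]

theorem toEnd_injective : Function.Injective (toEnd K R) := Subtype.val_injective

/-- The differential operator given by a derivation. -/
def ofDerivation (δ : Derivation K R R) : DiffOp K R := ⟨(δ : R →ₗ[K] R), 1, .derivation δ⟩

theorem toEnd_ofDerivation (δ : Derivation K R R) :
    toEnd K R (ofDerivation δ) = (δ : R →ₗ[K] R) := rfl

theorem toEnd_ofRing_eq (r : R) : toEnd K R (ofRing K R r) = LinearMap.mulLeft K r := rfl

theorem ofRing_injective : Function.Injective (ofRing K R) := by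
  intro r s h
  simpa [toEnd_ofRing] using LinearMap.congr_fun (congrArg (toEnd K R) h) 1

theorem ofDerivation_commutator (δ : Derivation K R R) (a : R) :
    ofDerivation δ * ofRing K R a - ofRing K R a * ofDerivation δ = ofRing K R (δ a) := by
  apply toEnd_injective
  ext f
  simp only [map_sub, map_mul, toEnd_ofDerivation, toEnd_ofRing_eq, LinearMap.sub_apply,
    Module.End.mul_apply, LinearMap.mulLeft_apply, Derivation.coeFn_coe, Derivation.leibniz,
    smul_eq_mul]
  ring

theorem ofRing_commute (a b : R) : Commute (ofRing K R a) (ofRing K R b) := by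
  rw [Commute, SemiconjBy, ← map_mul, mul_comm, map_mul]

/-- `D` as an `R`-module by right multiplication. -/
@[reducible] noncomputable def rightModule : Module R (DiffOp K R) :=
  Module.compHom (DiffOp K R) (RingEquiv.toOpposite R : R ≃+* Rᵐᵒᵖ).toRingHom

attribute [local instance] rightModule

theorem right_smul_def (r : R) (P : DiffOp K R) : r • P = P * ofRing K R r := rfl

theorem toOpposite_smul (r : R) (P : DiffOp K R) : RingEquiv.toOpposite R r • P = r • P := rfl

/-- The commutator `P ↦ [P, a]`. -/
noncomputable def commutator (a : R) : DiffOp K R →ₗ[R] DiffOp K R where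
  toFun P := P * ofRing K R a - ofRing K R a * P
  map_add' P Q := by noncomm_ring
  map_smul' r P := by
    simp only [right_smul_def, RingHom.id_apply, sub_mul, mul_assoc, (ofRing_commute r a).eq]

theorem commutator_apply (a : R) (P : DiffOp K R) :
    commutator a P = P * ofRing K R a - ofRing K R a * P := rfl

theorem commutator_eq_zero_iff {a : R} {P : DiffOp K R} :
    commutator a P = 0 ↔ Commute P (ofRing K R a) := sub_eq_zero

theorem commutator_comm (a b : R) (P : DiffOp K R) :
    commutator a (commutator b P) = commutator b (commutator a P) := by
  have h := (ofRing_commute (K := K) a b).eq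
  have e : ∀ A B : DiffOp K R, (P * B - B * P) * A - A * (P * B - B * P) -
      ((P * A - A * P) * B - B * (P * A - A * P)) = (A * B - B * A) * P - P * (A * B - B * A) := by
    intro A B; noncomm_ring
  rw [← sub_eq_zero]
  simp only [commutator_apply]
  rw [e, h]; simp

/-- Each bracket lowers the order by one, so order at most `m` dies after `m + 1` brackets. -/
theorem exists_commutator_pow_eq_zero (a : R) (P : DiffOp K R) :
    ∃ k, (commutator a ^ k) P = 0 := by
  have key : ∀ (m : ℕ) (P : DiffOp K R), IsDiffOp K R m (toEnd K R P) →
      (commutator a ^ (m + 1)) P = 0 := by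
    intro m
    induction m with
    | zero => exact fun P hP => toEnd_injective (by simpa [commutator_apply, toEnd_ofRing_eq] using hP a)
    | succ m ih =>
      intro P hP
      rw [pow_succ, Module.End.mul_apply]
      exact ih _ (hP a)
  obtain ⟨m, hP⟩ := P.2
  exact ⟨m + 1, key m P hP⟩

theorem commutator_mul (a : R) (P Q : DiffOp K R) :
    commutator a (P * Q) = P * commutator a Q + commutator a P * Q := by
  simp only [commutator_apply]; noncomm_ring

end DiffOp

namespace DiffOp

/-! ### Normal ordering and the symbol calculus -/

section Monomials

variable {K R : Type*} [CommRing K] [CommRing R] [Algebra K R]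

attribute [local instance] rightModule

variable {n : ℕ} (d : Fin n → Derivation K R R)

/-- The operator `∂^α` as an element of `D`. -/
noncomputable def monomialOp (α : Fin n →₀ ℕ) : DiffOp K R :=
  (List.ofFn fun i => ofDerivation (d i) ^ α i).prod

theorem toEnd_monomialOp (α : Fin n →₀ ℕ) : toEnd K R (monomialOp d α) = derivMonomial d α := by
  rw [monomialOp, derivMonomial, map_list_prod, List.map_ofFn]
  congr 2

/-- Normally ordered operators: `∑ rₐ ξ^α ↦ ∑ ∂^α rₐ`. -/
noncomputable def ofSymbol : MvPolynomial (Fin n) R →ₗ[R] DiffOp K R :=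
  (MvPolynomial.basisMonomials (Fin n) R).constr R (monomialOp d)

theorem ofSymbol_monomial (α : Fin n →₀ ℕ) (r : R) :
    ofSymbol d (MvPolynomial.monomial α r) = monomialOp d α * ofRing K R r := by
  have h : MvPolynomial.monomial α r =
      r • MvPolynomial.basisMonomials (Fin n) R α := by
    simp [MvPolynomial.smul_monomial]
  rw [h, map_smul, ofSymbol, Module.Basis.constr_basis, right_smul_def]

theorem monomialOp_zero : monomialOp d 0 = 1 := by
  simp [monomialOp]

variable {d} {x : Fin n → R}

theorem monomialOp_add (hcomm : ∀ i j, Commute (ofDerivation (d i)) (ofDerivation (d j)))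
    (α β : Fin n →₀ ℕ) : monomialOp d (α + β) = monomialOp d α * monomialOp d β := by
  rw [monomialOp, monomialOp, monomialOp,
    ← List.prod_ofFn_mul_of_commute _ _ fun i j => (hcomm i j).pow_pow _ _]
  simp [pow_add]

theorem monomialOp_single (i : Fin n) (k : ℕ) :
    monomialOp d (Finsupp.single i k) = ofDerivation (d i) ^ k :=
  List.prod_ofFn_pow_single _ i k

/-- The Lie bracket of two derivations is a derivation, and it kills the `x k` because each `d i (x
k)` is 0 or 1. -/
theorem ofDerivation_commute (hder : ∀ δ : Derivation K R R, (∀ i, δ (x i) = 0) → δ = 0)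
    (hdx : ∀ i j, d i (x j) = if i = j then 1 else 0) (i j : Fin n) :
    Commute (ofDerivation (d i)) (ofDerivation (d j)) := by
  have h : ⁅d i, d j⁆ = 0 := hder _ fun k => by
    rw [Derivation.commutator_apply, hdx, hdx]
    split_ifs <;> simp
  apply toEnd_injective
  ext f
  have h' := Derivation.congr_fun h f
  rw [Derivation.commutator_apply] at h'
  simpa [toEnd_ofDerivation, sub_eq_zero] using h'

theorem ofDerivation_commute_ofRing (hdx : ∀ i j, d i (x j) = if i = j then 1 else 0)
    {i j : Fin n} (hij : i ≠ j) : Commute (ofDerivation (d i)) (ofRing K R (x j)) := by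
  rw [Commute, SemiconjBy, ← sub_eq_zero, ofDerivation_commutator, hdx, if_neg hij, map_zero]

theorem commutator_ofDerivation_pow (hdx : ∀ i j, d i (x j) = if i = j then 1 else 0)
    (i : Fin n) (k : ℕ) : commutator (x i) (ofDerivation (d i) ^ k) =
      k * ofDerivation (d i) ^ (k - 1) :=
  commutator_pow_of_commutator_eq_one
    (by rw [ofDerivation_commutator, hdx, if_pos rfl, map_one]) k

/-- Split off the `i`-th power: the remaining factors commute with `x i`. Truncated subtraction is
harmless, since the coefficient vanishes when `α i = 0`. -/
theorem commutator_monomialOp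
    (hcomm : ∀ i j, Commute (ofDerivation (d i)) (ofDerivation (d j)))
    (hdx : ∀ i j, d i (x j) = if i = j then 1 else 0) (i : Fin n) (α : Fin n →₀ ℕ) :
    commutator (x i) (monomialOp d α) = α i * monomialOp d (α - Finsupp.single i 1) := by
  have h1 : α = Finsupp.single i (α i) + α.erase i := (Finsupp.single_add_erase i α).symm
  have h2 : α - Finsupp.single i 1 = Finsupp.single i (α i - 1) + α.erase i := by
    ext j
    by_cases h : j = i
    · subst h; simp
    · simp [h]
  have h3 : commutator (x i) (monomialOp d (α.erase i)) = 0 := by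
    rw [commutator_eq_zero_iff]
    refine Commute.list_prod_left _ _ fun y hy => ?_
    obtain ⟨j, rfl⟩ := List.mem_ofFn.mp hy
    by_cases h : j = i
    · subst h; simp
    · exact (ofDerivation_commute_ofRing hdx h).pow_left _
  rw [h2, monomialOp_add hcomm]
  conv_lhs => rw [h1, monomialOp_add hcomm]
  rw [commutator_mul, h3, monomialOp_single, monomialOp_single,
    commutator_ofDerivation_pow hdx]
  simp [mul_assoc]

theorem ofSymbol_pderiv
    (hcomm : ∀ i j, Commute (ofDerivation (d i)) (ofDerivation (d j)))
    (hdx : ∀ i j, d i (x j) = if i = j then 1 else 0) (i : Fin n) (p : MvPolynomial (Fin n) R) :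
    ofSymbol d (MvPolynomial.pderiv i p) = commutator (x i) (ofSymbol d p) := by
  induction p using MvPolynomial.induction_on' with
  | add p q hp hq => simp only [map_add, hp, hq]
  | monomial α r =>
    rw [MvPolynomial.pderiv_monomial, ofSymbol_monomial, ofSymbol_monomial, ← right_smul_def r,
      map_smul, commutator_monomialOp hcomm hdx, right_smul_def, mul_comm r, map_mul, map_natCast,
      ← mul_assoc, Nat.cast_comm]

/-- Coefficients stand to the right of the derivatives, so no correction terms arise. -/
theorem ofSymbol_X_pow_mul
    (hcomm : ∀ i j, Commute (ofDerivation (d i)) (ofDerivation (d j))) (i : Fin n) (k : ℕ)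
    (p : MvPolynomial (Fin n) R) :
    ofSymbol d (MvPolynomial.X i ^ k * p) = ofDerivation (d i) ^ k * ofSymbol d p := by
  induction p using MvPolynomial.induction_on' with
  | add p q hp hq => simp only [map_add, mul_add, hp, hq]
  | monomial α r =>
    rw [MvPolynomial.X_pow_eq_monomial, MvPolynomial.monomial_mul, ofSymbol_monomial,
      ofSymbol_monomial, monomialOp_add hcomm, monomialOp_single, one_mul, mul_assoc]

/-- The analogue of `(d/dt)^k t^k = k!`, with `Q` in the role of a constant; it identifies the term
to subtract in the proof of surjectivity. -/
theorem commutator_pow_ofDerivation_pow_mul (hdx : ∀ i j, d i (x j) = if i = j then 1 else 0)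
    {i : Fin n} {Q : DiffOp K R} (hQ : commutator (x i) Q = 0) (k : ℕ) :
    (commutator (x i) ^ k) (ofDerivation (d i) ^ k * Q) = k.factorial * Q := by
  induction k with
  | zero => simp
  | succ k ih =>
    have e : commutator (x i) (ofDerivation (d i) ^ (k + 1) * Q) =
        (k + 1) • (ofDerivation (d i) ^ k * Q) := by
      rw [commutator_mul, hQ, commutator_ofDerivation_pow hdx, mul_zero, zero_add,
        Nat.add_sub_cancel, mul_assoc, nsmul_eq_mul]
    rw [pow_succ, Module.End.mul_apply, e, map_nsmul, ih, nsmul_eq_mul, Nat.factorial_succ,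
      Nat.cast_mul, mul_assoc]

end Monomials

/-! ### Freeness of `D` over `R` -/

section Basis

variable {K R : Type*} [Field K] [CharZero K] [CommRing R] [Algebra K R]

attribute [local instance] rightModule

variable {n : ℕ} {d : Fin n → Derivation K R R} {x : Fin n → R}

/-- This is where characteristic zero enters: exponents and factorials have to be inverted in `R`.
-/
theorem isUnit_natCast_of_ne_zero (K : Type*) [Field K] [CharZero K] {R : Type*} [CommRing R]
    [Algebra K R] {k : ℕ} (hk : k ≠ 0) : IsUnit (k : R) := by
  have h : IsUnit (k : K) := (Nat.cast_ne_zero.mpr hk).isUnit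
  simpa using h.map (algebraMap K R)

theorem ofSymbol_injective
    (hcomm : ∀ i j, Commute (ofDerivation (d i)) (ofDerivation (d j)))
    (hdx : ∀ i j, d i (x j) = if i = j then 1 else 0) : Function.Injective (ofSymbol d) := by
  -- Here `m` is a strict bound on the degree, so `m = 0` leaves no coefficient at all.
  have key : ∀ (m : ℕ) (p : MvPolynomial (Fin n) R),
      (∀ α : Fin n →₀ ℕ, m ≤ α.degree → p.coeff α = 0) → ofSymbol d p = 0 → p = 0 := by
    intro m
    induction m with
    | zero => exact fun p h _ => MvPolynomial.ext _ _ fun α => by simpa using h α (Nat.zero_le _)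
    | succ m ih =>
      intro p hdeg hp
      have hpd : ∀ i, MvPolynomial.pderiv i p = 0 := fun i => by
        refine ih _ (fun α hα => ?_) (by rw [ofSymbol_pderiv hcomm hdx, hp, map_zero])
        rw [MvPolynomial.coeff_pderiv, hdeg _ (by simpa using hα), zero_mul]
      -- All partial derivatives vanish and the exponents are units, so only the constant term
      -- survives.
      have hc : p = MvPolynomial.monomial 0 (p.coeff 0) := by
        ext α
        rw [MvPolynomial.coeff_monomial]
        split_ifs with h
        · rw [h]
        · obtain ⟨i, hi⟩ : ∃ i, α i ≠ 0 := by
            by_contra! hα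
            exact h (Finsupp.ext fun i => (hα i).symm)
          have h' := congrArg (MvPolynomial.coeff (α - Finsupp.single i 1)) (hpd i)
          have hle : Finsupp.single i 1 ≤ α := by simpa using Nat.one_le_iff_ne_zero.mpr hi
          rw [MvPolynomial.coeff_pderiv, tsub_add_cancel_of_le hle, MvPolynomial.coeff_zero] at h'
          have hu := isUnit_natCast_of_ne_zero K (R := R) hi
          have e : (((α - Finsupp.single i 1 : Fin n →₀ ℕ) i : ℕ) : R) + 1 = (α i : ℕ) := by
            rw [← Nat.cast_succ]
            congr 1
            simp; omega
          rw [e] at h'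
          exact hu.mul_left_eq_zero.mp h'
      rw [hc, ofSymbol_monomial, monomialOp_zero, one_mul] at hp
      rw [hc, ofRing_injective (hp.trans (map_zero _).symm), MvPolynomial.monomial_zero]
  rw [← LinearMap.ker_eq_bot, LinearMap.ker_eq_bot']
  intro p hp
  refine key (p.totalDegree + 1) p (fun α hα => ?_) hp
  exact MvPolynomial.coeff_eq_zero_of_totalDegree_lt (by
    simpa [Finsupp.degree_apply] using hα)

theorem ofSymbol_surjective (hder : ∀ δ : Derivation K R R, (∀ i, δ (x i) = 0) → δ = 0)
    (hcomm : ∀ i j, Commute (ofDerivation (d i)) (ofDerivation (d j)))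
    (hdx : ∀ i j, d i (x j) = if i = j then 1 else 0) : Function.Surjective (ofSymbol d) := by
  -- The set `s` holds the variables whose bracket with `P` may be nonzero; the inner induction
  -- below is on the nilpotency exponent for the variable being removed.
  have key : ∀ (s : Finset (Fin n)) (P : DiffOp K R),
      (∀ i ∉ s, commutator (x i) P = 0) → P ∈ LinearMap.range (ofSymbol d) := by
    intro s
    induction s using Finset.induction_on with
    | empty =>
      intro P hP
      obtain ⟨m, hm⟩ := P.2
      have h := IsDiffOp.eq_mulLeft_of_commute x hder m (toEnd K R P) hm fun i => by
        have := (commutator_eq_zero_iff.mp (hP i (by simp))).map (toEnd K R)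
        exact this
      refine ⟨MvPolynomial.monomial 0 (toEnd K R P 1), ?_⟩
      rw [ofSymbol_monomial, monomialOp_zero, one_mul]
      exact toEnd_injective h.symm
    | insert i s _ ih =>
      intro P hP
      obtain ⟨k, hk⟩ := exists_commutator_pow_eq_zero (x i) P
      induction k generalizing P with
      | zero => rw [show P = 0 by simpa using hk]; exact zero_mem _
      | succ k ihk =>
        set Q := (commutator (x i) ^ k) P with hQdef
        have hQi : commutator (x i) Q = 0 := by
          rw [hQdef, ← Module.End.mul_apply, ← pow_succ']; exact hk
        have hQj : ∀ j ∉ insert i s, commutator (x j) Q = 0 := by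
          intro j hj
          have hc : Commute (commutator (K := K) (x j)) (commutator (x i)) :=
            LinearMap.ext fun P => commutator_comm _ _ P
          rw [hQdef, ← Module.End.mul_apply, (hc.pow_right k).eq, Module.End.mul_apply, hP j hj,
            map_zero]
        have hQ : ∀ j ∉ s, commutator (x j) Q = 0 := by
          intro j hj
          by_cases hji : j = i
          · rw [hji, hQi]
          · exact hQj j (by simp [hji, hj])
        -- With `c = 1 / k!`, the operator `P - c • ∂ᵢ^k Q` is killed by `k` brackets instead of `k
        -- + 1`, and brackets outside `insert i s` still vanish.
        obtain ⟨c, hc⟩ := (isUnit_natCast_of_ne_zero K (R := R) k.factorial_ne_zero).exists_left_inv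
        obtain ⟨q, hq⟩ := ih Q hQ
        have hmem : ofDerivation (d i) ^ k * Q ∈ LinearMap.range (ofSymbol d) :=
          ⟨MvPolynomial.X i ^ k * q, by rw [ofSymbol_X_pow_mul hcomm, hq]⟩
        have hsub : P - c • (ofDerivation (d i) ^ k * Q) ∈ LinearMap.range (ofSymbol d) := by
          refine ihk _ (fun j hj => ?_) ?_
          · have hji : i ≠ j := by rintro rfl; simp at hj
            rw [map_sub, map_smul, hP j hj, commutator_mul, hQj j hj,
              commutator_eq_zero_iff.mpr ((ofDerivation_commute_ofRing hdx hji).pow_left k)]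
            simp
          · rw [map_sub, map_smul, commutator_pow_ofDerivation_pow_mul hdx hQi, ← hQdef,
              ← nsmul_eq_mul, ← Nat.cast_smul_eq_nsmul R, smul_smul, hc, one_smul, sub_self]
        have := add_mem hsub (Submodule.smul_mem _ c hmem)
        rwa [sub_add_cancel] at this
  intro P
  exact key Finset.univ P (by simp)

/-- The operators `∂^α` form a basis of the right `R`-module `D`. -/
theorem exists_basis_monomialOp (hder : ∀ δ : Derivation K R R, (∀ i, δ (x i) = 0) → δ = 0)
    (hdx : ∀ i j, d i (x j) = if i = j then 1 else 0) :
    ∃ b : Module.Basis (Fin n →₀ ℕ) Rᵐᵒᵖ (DiffOp K R), ∀ α, b α = monomialOp d α := by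
  have hcomm := ofDerivation_commute hder hdx
  let b := (MvPolynomial.basisMonomials (Fin n) R).map
    (LinearEquiv.ofBijective (ofSymbol d)
      ⟨ofSymbol_injective hcomm hdx, ofSymbol_surjective hder hcomm hdx⟩)
  refine ⟨b.mapCoeffs (RingEquiv.toOpposite R) toOpposite_smul, fun α => ?_⟩
  rw [Module.Basis.mapCoeffs_apply]
  have h : ofSymbol d (MvPolynomial.monomial α 1) = monomialOp d α := by
    rw [ofSymbol_monomial, map_one, mul_one]
  simpa [b] using! h

end Basis

end DiffOp

/-! ### Injective modules under restriction of scalars -/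

/-- Injectivity descends along a ring homomorphism `φ : R → D` from a commutative ring that makes
`D` a flat right module. -/
theorem Module.Injective.of_flat_right {R : Type*} {D : Type u} {E : Type (max u v)} [CommRing R]
    [Ring D] (φ : R →+* D) [Module R D] (hD : ∀ (r : R) (P : D), r • P = P * φ r)
    [Module.Flat R D] [AddCommGroup E] [Module D E] [Module R E]
    (hE : ∀ (r : R) (e : E), r • e = φ r • e) (h : Module.Injective D E) :
    Module.Injective R E := by
  refine ⟨fun X Y _ _ _ _ f hf g => ?_⟩
  -- The bimodule structure of `D` makes `D ⊗ X` a left `D`-module.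
  have : SMulCommClass R D D := ⟨fun r P Q => by simp only [hD, smul_eq_mul, mul_assoc]⟩
  let F : TensorProduct R D X →ₗ[D] TensorProduct R D Y :=
    { f.lTensor D with
      map_smul' := fun P t => by
        change f.lTensor D (P • t) = P • f.lTensor D t
        induction t using TensorProduct.induction_on with
        | zero => simp
        | tmul Q x => simp [TensorProduct.smul_tmul']
        | add s t hs ht => rw [smul_add, map_add, hs, ht, map_add, smul_add] }
  have hF : Function.Injective F := Module.Flat.lTensor_preserves_injective_linearMap f hf
  -- The map `P ⊗ x ↦ P • g x` is the adjoint of `g`.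
  let B : D →+ X →+ E := AddMonoidHom.mk' (fun P => AddMonoidHom.mk' (fun x => P • g x)
    fun x y => by rw [map_add, smul_add]) fun P Q => by ext x; simp [add_smul]
  let G₀ : TensorProduct R D X →+ E := TensorProduct.liftAddHom B fun r P x => by
    simp [B, hD, hE, mul_smul]
  have hG₀ : ∀ P x, G₀ (P ⊗ₜ x) = P • g x := fun P x => TensorProduct.liftAddHom_tmul _ _ _ _
  let G : TensorProduct R D X →ₗ[D] E :=
    { G₀ with
      map_smul' := fun P t => by
        change G₀ (P • t) = P • G₀ t
        induction t using TensorProduct.induction_on with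
        | zero => simp
        | tmul Q x => rw [TensorProduct.smul_tmul', hG₀, hG₀, smul_eq_mul, mul_smul]
        | add s t hs ht => rw [smul_add, map_add, hs, ht, map_add, smul_add] }
  obtain ⟨H, hH⟩ := h.out F hF G
  -- Transposing back: `R`-linearity holds because `1 ⊗ r y = φ r ⊗ y = φ r • (1 ⊗ y)`.
  refine ⟨{ toFun := fun y => H (1 ⊗ₜ y)
            map_add' := fun y z => by rw [TensorProduct.tmul_add, map_add]
            map_smul' := fun r y => ?_ }, fun x => ?_⟩
  · rw [← TensorProduct.smul_tmul, hD, one_mul, RingHom.id_apply, hE, ← map_smul,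
      TensorProduct.smul_tmul', smul_eq_mul, mul_one]
  · have h1 : H (1 ⊗ₜ f x) = G (1 ⊗ₜ x) := hH (1 ⊗ₜ x)
    have h2 : G (1 ⊗ₜ x) = (1 : D) • g x := hG₀ 1 x
    exact h1.trans (h2.trans (one_smul _ _))

namespace DiffOp

theorem injective_restrictScalars {K R : Type u} [CommRing K] [CommRing R] [Algebra K R]
    [hfree : Module.Free Rᵐᵒᵖ (DiffOp K R)] {E : Type (max u v)} [AddCommGroup E]
    [Module (DiffOp K R) E] [Module R E] (hE : ∀ (r : R) (e : E), r • e = ofRing K R r • e)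
    (h : Module.Injective (DiffOp K R) E) : Module.Injective R E := by
  let : Module R (DiffOp K R) := rightModule
  have : Module.Free R (DiffOp K R) := Module.Free.of_basis
    ((Module.Free.chooseBasis Rᵐᵒᵖ (DiffOp K R)).mapCoeffs (RingEquiv.toOpposite R).symm
      fun _ _ => rfl)
  exact Module.Injective.of_flat_right (ofRing K R) right_smul_def hE h

end DiffOp

/-! ### Division by the variables and rigidity of derivations -/

namespace MvPowerSeries

variable {n : ℕ} {K : Type*}

/-- The quotients in the division `f = f(0) + ∑ Xᵢ gᵢ` in which `gᵢ` involves only the variables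
`Xᵢ, …, Xₙ`. -/
noncomputable def divVar [Semiring K] (i : Fin n) (f : MvPowerSeries (Fin n) K) :
    MvPowerSeries (Fin n) K :=
  open Classical in
  fun α => if ∀ j < i, α j = 0 then coeff (α + Finsupp.single i 1) f else 0

open Classical in
theorem coeff_divVar [Semiring K] (i : Fin n) (f : MvPowerSeries (Fin n) K) (α : Fin n →₀ ℕ) :
    coeff α (divVar i f) = if ∀ j < i, α j = 0 then coeff (α + Finsupp.single i 1) f else 0 :=
  rfl

/-- Each nonconstant monomial is assigned to the variable of smallest index dividing it, so it is
counted exactly once. -/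
theorem eq_C_add_sum_X_mul_divVar [CommSemiring K] (f : MvPowerSeries (Fin n) K) :
    f = C (coeff 0 f) + ∑ i, X i * divVar i f := by
  classical
  ext α
  have hX : ∀ i, coeff α (X i * divVar i f) =
      if α i ≠ 0 ∧ ∀ j < i, α j = 0 then coeff α f else 0 := by
    intro i
    rw [X, coeff_monomial_mul, one_mul]
    by_cases hi : α i = 0
    · simp [hi]
    · have hle : Finsupp.single i 1 ≤ α := by simpa using Nat.one_le_iff_ne_zero.mpr hi
      rw [if_pos hle, coeff_divVar, tsub_add_cancel_of_le hle]
      congr 1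
      simp only [hi, ne_eq, not_false_eq_true, true_and, eq_iff_iff]
      refine forall₂_congr fun j hj => ?_
      simp [hj.ne']
  rw [map_add, map_sum, coeff_C, Finset.sum_congr rfl fun i _ => hX i]
  by_cases h0 : α = 0
  · simp [h0]
  · have hne : α.support.Nonempty := Finsupp.support_nonempty_iff.mpr h0
    rw [if_neg h0, zero_add, Finset.sum_eq_single (α.support.min' hne)]
    · rw [if_pos]
      refine ⟨Finsupp.mem_support_iff.mp (Finset.min'_mem _ _), fun j hj => ?_⟩
      by_contra hj0
      exact absurd (Finset.min'_le _ j (Finsupp.mem_support_iff.mpr hj0)) (not_le.mpr hj)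
    · intro i _ hi
      rw [if_neg]
      rintro ⟨h1, h2⟩
      refine hi (le_antisymm (le_of_not_gt fun hlt => ?_)
        (Finset.min'_le _ i (Finsupp.mem_support_iff.mpr h1))) |>.elim
      exact Finsupp.mem_support_iff.mp (Finset.min'_mem _ hne) (h2 _ hlt)
    · simp

/-- A derivation of a ring of power series that is closed under division by the variables vanishes
if it kills the variables. -/
theorem derivation_eq_zero_of_division [CommRing K] {R : Type*} [CommRing R] [Algebra K R]
    (ι : R →ₐ[K] MvPowerSeries (Fin n) K) (hι : Function.Injective ι) (x : Fin n → R)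
    (hx : ∀ i, ι (x i) = X i)
    (hdiv : ∀ f : R, ∃ (c : K) (g : Fin n → R), f = algebraMap K R c + ∑ i, x i * g i)
    (δ : Derivation K R R) (hδ : ∀ i, δ (x i) = 0) : δ = 0 := by
  classical
  -- The induction runs over all `f` at once, because it is applied to the quotients `g i`; the
  -- factor `x i` gains one degree.
  have key : ∀ (k : ℕ) (f : R) (α : Fin n →₀ ℕ), α.degree < k → coeff α (ι (δ f)) = 0 := by
    intro k
    induction k with
    | zero => intro f α h; omega
    | succ k ih =>
      intro f α hα
      obtain ⟨c, g, rfl⟩ := hdiv f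
      simp only [map_add, map_sum, Derivation.leibniz, Derivation.map_algebraMap, hδ,
        smul_eq_mul, map_mul, hx, zero_add, mul_zero, add_zero]
      refine Finset.sum_eq_zero fun i _ => ?_
      rw [X, coeff_monomial_mul]
      split_ifs with h
      · rw [ih, mul_zero]
        have h' := congrArg Finsupp.degree (tsub_add_cancel_of_le h)
        rw [map_add, Finsupp.degree_single] at h'
        omega
      · rfl
  ext f
  apply hι
  ext α
  simpa using key _ f α (Nat.lt_succ_self _)

end MvPowerSeries

/-! ### Convergence of derivatives and quotients -/

namespace IsConvergentSeries

variable {n : ℕ}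

/-- Halving the radius absorbs `2 ^ α.degree`, and the index shift costs a factor `r⁻¹`. One
majorant serves both `∂ᵢ` and division. -/
theorem of_forall_norm_coeff_le {f g : MvPowerSeries (Fin n) ℂ} (i : Fin n)
    (hf : IsConvergentSeries f)
    (h : ∀ α : Fin n →₀ ℕ, ‖MvPowerSeries.coeff α g‖ ≤
      2 ^ α.degree * ‖MvPowerSeries.coeff (α + Finsupp.single i 1) f‖) :
    IsConvergentSeries g := by
  obtain ⟨r, hr, hf⟩ := hf
  refine ⟨r / 2, by positivity, ?_⟩
  have hs := (hf.comp_injective (i := fun α : Fin n →₀ ℕ => α + Finsupp.single i 1)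
    (add_left_injective _)).mul_left r⁻¹
  refine Summable.of_nonneg_of_le (fun α => by positivity) (fun α => ?_) hs
  refine (mul_le_mul_of_nonneg_right (h α) (by positivity)).trans (le_of_eq ?_)
  simp only [Function.comp_apply, map_add, Finsupp.degree_single, div_pow]
  field_simp
  ring

theorem X (i : Fin n) : IsConvergentSeries (MvPowerSeries.X i) := by
  classical
  refine ⟨1, one_pos, summable_of_ne_finset_zero (s := {Finsupp.single i 1}) fun α hα => ?_⟩
  rw [MvPowerSeries.coeff_X, if_neg (by simpa using hα)]
  simp

theorem pderiv (i : Fin n) {f : MvPowerSeries (Fin n) ℂ} (hf : IsConvergentSeries f) :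
    IsConvergentSeries (MvPowerSeries.pderiv ℂ i f) := by
  refine hf.of_forall_norm_coeff_le i fun α => ?_
  rw [MvPowerSeries.coeff_pderiv, norm_mul, mul_comm]
  gcongr
  rw [← Nat.cast_succ, Complex.norm_natCast]
  have h1 : α i ≤ α.degree := Finsupp.le_degree i α
  have h2 := α.degree.lt_two_pow_self
  exact_mod_cast (by omega : (α i).succ ≤ 2 ^ α.degree)

theorem divVar (i : Fin n) {f : MvPowerSeries (Fin n) ℂ} (hf : IsConvergentSeries f) :
    IsConvergentSeries (MvPowerSeries.divVar i f) := by
  classical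
  refine hf.of_forall_norm_coeff_le i fun α => ?_
  rw [MvPowerSeries.coeff_divVar]
  split_ifs
  · exact le_mul_of_one_le_left (norm_nonneg _) (one_le_pow₀ one_le_two)
  · rw [norm_zero]; positivity

end IsConvergentSeries

/-! ### The ring of convergent series -/

namespace convergentPowerSeries

variable {n : ℕ}

/-- The variable `zᵢ` as a convergent power series. -/
noncomputable def X (i : Fin n) : convergentPowerSeries n :=
  ⟨MvPowerSeries.X i, IsConvergentSeries.X i⟩

/-- The partial derivative `∂ᵢ` on convergent power series. -/
noncomputable def pderiv (i : Fin n) :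
    Derivation ℂ (convergentPowerSeries n) (convergentPowerSeries n) :=
  Derivation.mk'
    (((MvPowerSeries.pderiv ℂ i : MvPowerSeries (Fin n) ℂ →ₗ[ℂ] MvPowerSeries (Fin n) ℂ).restrict
      (p := Subalgebra.toSubmodule (convergentPowerSeries n))
      (q := Subalgebra.toSubmodule (convergentPowerSeries n))
      fun _ hf => IsConvergentSeries.pderiv i hf))
    fun f g => Subtype.ext ((MvPowerSeries.pderiv ℂ i).leibniz f.1 g.1)

theorem coe_pderiv (i : Fin n) (f : convergentPowerSeries n) :
    (pderiv i f : MvPowerSeries (Fin n) ℂ) = MvPowerSeries.pderiv ℂ i f := rfl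

theorem pderiv_X (i j : Fin n) : pderiv i (X j) = if i = j then 1 else 0 := by
  apply Subtype.ext
  rw [coe_pderiv, X, MvPowerSeries.pderiv_X, Pi.single_apply]
  simp only [eq_comm (a := j)]
  split_ifs <;> rfl

theorem derivation_eq_zero (δ : Derivation ℂ (convergentPowerSeries n) (convergentPowerSeries n))
    (hδ : ∀ i, δ (X i) = 0) : δ = 0 := by
  refine MvPowerSeries.derivation_eq_zero_of_division (convergentPowerSeries n).val
    Subtype.val_injective X (fun _ => rfl) (fun f => ?_) δ hδ
  refine ⟨MvPowerSeries.coeff 0 f.1, fun i => ⟨_, f.2.divVar i⟩, ?_⟩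
  apply Subtype.ext
  simpa [X] using! MvPowerSeries.eq_C_add_sum_X_mul_divVar f.1

/-- Lets the basis be described through formal partial derivatives of the underlying series. -/
theorem coe_derivMonomial (α : Fin n →₀ ℕ) (f : convergentPowerSeries n) :
    (derivMonomial pderiv α f : MvPowerSeries (Fin n) ℂ) =
      derivMonomial (fun i => MvPowerSeries.pderiv ℂ i) α (f : MvPowerSeries (Fin n) ℂ) := by
  have hpow : ∀ (i : Fin n) (k : ℕ) (f : convergentPowerSeries n),
      ((((pderiv i : convergentPowerSeries n →ₗ[ℂ] _) : Module.End ℂ _) ^ k) f :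
        MvPowerSeries (Fin n) ℂ) =
      (((MvPowerSeries.pderiv ℂ i : MvPowerSeries (Fin n) ℂ →ₗ[ℂ] _) : Module.End ℂ _) ^ k)
        (f : MvPowerSeries (Fin n) ℂ) := by
    intro i k
    induction k with
    | zero => simp
    | succ k ih => intro f; simp [pow_succ, ih, coe_pderiv]
  have hlist : ∀ l : List (Fin n),
      (((l.map fun i => ((pderiv i : convergentPowerSeries n →ₗ[ℂ] _) :
        Module.End ℂ _) ^ α i).prod) f : MvPowerSeries (Fin n) ℂ) =
      ((l.map fun i => ((MvPowerSeries.pderiv ℂ i : MvPowerSeries (Fin n) ℂ →ₗ[ℂ] _) :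
        Module.End ℂ _) ^ α i).prod) (f : MvPowerSeries (Fin n) ℂ) := by
    intro l
    induction l with
    | nil => simp
    | cons i l ih => simp [hpow, ih]
  simpa [derivMonomial, List.ofFn_eq_map] using hlist (List.finRange n)

end convergentPowerSeries

/-! ### The common statement and the three rings -/

namespace DiffOp

/-- The right module `D` is free on the `∂^α`, and injective `D`-modules are injective over `R`,
for any ring `R` with partial derivatives dual to `x₁, …, xₙ` in which derivations are determined
by their values at the `xᵢ`. -/
theorem free_and_basis_and_injective {K R : Type u} [Field K] [CharZero K] [CommRing R]
    [Algebra K R] {n : ℕ} {d : Fin n → Derivation K R R} {x : Fin n → R}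
    (hder : ∀ δ : Derivation K R R, (∀ i, δ (x i) = 0) → δ = 0)
    (hdx : ∀ i j, d i (x j) = if i = j then 1 else 0) :
    Module.Free Rᵐᵒᵖ (DiffOp K R) ∧
      (∃ b : Module.Basis (Fin n →₀ ℕ) Rᵐᵒᵖ (DiffOp K R),
        ∀ (α : Fin n →₀ ℕ) (f : R), toEnd K R (b α) f = derivMonomial d α f) ∧
      ∀ (E : Type (max u v)) [AddCommGroup E] [Module (DiffOp K R) E] [Module R E],
        (∀ (r : R) (e : E), r • e = ofRing K R r • e) →
        Module.Injective (DiffOp K R) E → Module.Injective R E := by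
  obtain ⟨b, hb⟩ := exists_basis_monomialOp hder hdx
  have hfree := Module.Free.of_basis b
  refine ⟨hfree, ⟨b, fun α f => by rw [hb, toEnd_monomialOp]⟩, ?_⟩
  intro E _ _ _ hE h
  exact injective_restrictScalars.{u, v} hE h

end DiffOp

theorem mainTheorem7 (n : ℕ) :
    -- `R = K[X₁, …, Xₙ]`
    (∀ (K : Type u) [Field K] [CharZero K],
      Module.Free (MvPolynomial (Fin n) K)ᵐᵒᵖ (DiffOp K (MvPolynomial (Fin n) K)) ∧
      (∃ b : Module.Basis (Fin n →₀ ℕ) (MvPolynomial (Fin n) K)ᵐᵒᵖ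
          (DiffOp K (MvPolynomial (Fin n) K)),
        ∀ (α : Fin n →₀ ℕ) (f : MvPolynomial (Fin n) K),
          DiffOp.toEnd K (MvPolynomial (Fin n) K) (b α) f =
            derivMonomial (fun i => MvPolynomial.pderiv i) α f) ∧
      ∀ (E : Type (max u v)) [AddCommGroup E] [Module (DiffOp K (MvPolynomial (Fin n) K)) E]
        [Module (MvPolynomial (Fin n) K) E],
        (∀ (r : MvPolynomial (Fin n) K) (e : E),
          r • e = DiffOp.ofRing K (MvPolynomial (Fin n) K) r • e) →
        Module.Injective (DiffOp K (MvPolynomial (Fin n) K)) E →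
        Module.Injective (MvPolynomial (Fin n) K) E) ∧
    -- `R = K[[X₁, …, Xₙ]]`
    (∀ (K : Type u) [Field K] [CharZero K],
      Module.Free (MvPowerSeries (Fin n) K)ᵐᵒᵖ (DiffOp K (MvPowerSeries (Fin n) K)) ∧
      (∃ b : Module.Basis (Fin n →₀ ℕ) (MvPowerSeries (Fin n) K)ᵐᵒᵖ
          (DiffOp K (MvPowerSeries (Fin n) K)),
        ∀ (α : Fin n →₀ ℕ) (f : MvPowerSeries (Fin n) K),
          DiffOp.toEnd K (MvPowerSeries (Fin n) K) (b α) f =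
            derivMonomial (fun i => MvPowerSeries.pderiv K i) α f) ∧
      ∀ (E : Type (max u v)) [AddCommGroup E] [Module (DiffOp K (MvPowerSeries (Fin n) K)) E]
        [Module (MvPowerSeries (Fin n) K) E],
        (∀ (r : MvPowerSeries (Fin n) K) (e : E),
          r • e = DiffOp.ofRing K (MvPowerSeries (Fin n) K) r • e) →
        Module.Injective (DiffOp K (MvPowerSeries (Fin n) K)) E →
        Module.Injective (MvPowerSeries (Fin n) K) E) ∧
    -- `R = ℂ{z₁, …, zₙ}`
    (Module.Free (convergentPowerSeries n)ᵐᵒᵖ (DiffOp ℂ (convergentPowerSeries n)) ∧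
      (∃ b : Module.Basis (Fin n →₀ ℕ) (convergentPowerSeries n)ᵐᵒᵖ
          (DiffOp ℂ (convergentPowerSeries n)),
        ∀ (α : Fin n →₀ ℕ) (f : convergentPowerSeries n),
          (DiffOp.toEnd ℂ (convergentPowerSeries n) (b α) f : MvPowerSeries (Fin n) ℂ) =
            derivMonomial (fun i => MvPowerSeries.pderiv ℂ i) α
              (f : MvPowerSeries (Fin n) ℂ)) ∧
      ∀ (E : Type v) [AddCommGroup E] [Module (DiffOp ℂ (convergentPowerSeries n)) E]
        [Module (convergentPowerSeries n) E],
        (∀ (r : convergentPowerSeries n) (e : E),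
          r • e = DiffOp.ofRing ℂ (convergentPowerSeries n) r • e) →
        Module.Injective (DiffOp ℂ (convergentPowerSeries n)) E →
        Module.Injective (convergentPowerSeries n) E) := by
  refine ⟨fun K _ _ => ?_, fun K _ _ => ?_, ?_⟩
  · exact DiffOp.free_and_basis_and_injective.{u, v} (x := MvPolynomial.X)
      (fun δ h => MvPolynomial.derivation_ext fun i => by rw [h, Derivation.zero_apply])
      fun i j => by rw [MvPolynomial.pderiv_X, Pi.single_apply]; simp only [eq_comm (a := j)]
  · refine DiffOp.free_and_basis_and_injective.{u, v} (x := MvPowerSeries.X) (fun δ h => ?_)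
      fun i j => by rw [MvPowerSeries.pderiv_X, Pi.single_apply]; simp only [eq_comm (a := j)]
    exact MvPowerSeries.derivation_eq_zero_of_division (AlgHom.id K _) Function.injective_id
      MvPowerSeries.X (fun _ => rfl)
      (fun f => ⟨_, fun i => f.divVar i, f.eq_C_add_sum_X_mul_divVar⟩) δ h
  · obtain ⟨h1, ⟨b, hb⟩, h3⟩ := DiffOp.free_and_basis_and_injective.{0, v}
      (K := ℂ) (R := convergentPowerSeries n) (d := convergentPowerSeries.pderiv)
      (x := convergentPowerSeries.X)
      convergentPowerSeries.derivation_eq_zero convergentPowerSeries.pderiv_X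
    refine ⟨h1, ⟨b, fun α f => ?_⟩, h3⟩
    rw [hb, convergentPowerSeries.coe_derivMonomial]
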